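/- Fix a countably infinite set $\mathbf U$ (the universe). A database schema $\tau$ is a finite nonempty set of relation symbols $R$, each with an arity $\mathrm{ar}(R)\in\mathbb N$. A $\tau$-fact is an expression $R(u_1,\dots,u_{\mathrm{ar}(R)})$ with $R\in\tau$ and $u_i\in\mathbf U$, and a $\tau$-instance is a finite set of $\tau$-facts; its size is its number of facts. A probabilistic database (PDB) of schema $\tau$ over $\mathbf U$ is a discrete probability space $\mathcal D=(\mathbb D,P)$ whose sample space $\mathbb D$ is a set of $\tau$-instances. Its possible worlds are the instances $D\in\mathbb D$ with $P(\{D\})>0$. It is of bounded instance size if there is $c\in\mathbb N$ such that every possible world has size at most $c$. It is tuple-independent (TI) if for all finite sets $\{f_1,\dots,f_k\}$ of pairwise distinct facts that appear in possible worlds, $\Pr_{D\sim\mathcal D}(f_1\in D,\dots,f_k\in D)=\prod_{i=1}^k\Pr_{D\sim\mathcal D}(f_i\in D)$. A first-order view $V$ from a schema $\sigma$ to a schema $\tau$ consists of a first-order formula $\Phi_R(x_1,\dots,x_{\mathrm{ar}(R)})$ over $\sigma$, with equality and with constants from $\mathbf U$, for every $R\in\tau$. It maps a $\sigma$-instance $I$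 to the $\tau$-instance $V(I)$ of all facts $R(a_1,\dots,a_{\mathrm{ar}(R)})$ such that all $a_i\in\mathrm{adom}(I,\Phi_R)$ and $I\models\Phi_R(a_1,\dots,a_{\mathrm{ar}(R)})$, where quantifiers range over the active domain $\mathrm{adom}(I,\Phi_R)$, the set of all elements of $\mathbf U$ that occur in facts of $I$ or as constants in $\Phi_R$. The class $\mathrm{FO}(\mathrm{TI})$ consists of all PDBs $(\mathbb D,P)$ for which there are a tuple-independent PDB $(\mathbb I,Q)$ over $\mathbf U$, of some schema, and a first-order view $V$ with $V(\mathbb I)\subseteq\mathbb D$ and $P(\{D\})=Q(\{I\in\mathbb I: V(I)=D\})$ for all $D\in\mathbb D$. **Statement.** Every PDB of bounded instance size over $\mathbf U$ (of any schema, and possibly with infinitely many possible worlds) belongs to $\mathrm{FO}(\mathrm{TI})$. -/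

import Mathlib

namespace ProbDB

/-- A database schema: a finite nonempty set of relation symbols, each with an arity in `ℕ`. -/
structure Schema where
  Rel : Type
  [fintypeRel : Fintype Rel]
  [nonemptyRel : Nonempty Rel]
  arity : Rel → ℕ

attribute [instance] Schema.fintypeRel Schema.nonemptyRel

/-- The facts `R(u₁, …, u_r)` over the schema `τ` with entries in the universe `U`. -/
abbrev Fact (τ : Schema) (U : Type*) : Type _ :=
  Σ R : τ.Rel, (Fin (τ.arity R) → U)

/-- A database instance is a finite set of facts. Its size is its cardinality. -/
abbrev Instance (τ : Schema) (U : Type*) : Type _ :=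
  Finset (Fact τ U)

/-- Terms: one of `n` variables, or a constant from the universe. -/
inductive Term (U : Type*) (n : ℕ) : Type _
  | var (i : Fin n) : Term U n
  | const (c : U) : Term U n

/-- The value of a term under a valuation of its variables. -/
def Term.eval {U : Type*} {n : ℕ} (v : Fin n → U) : Term U n → U
  | .var i => v i
  | .const c => c

/-- The constants appearing in a term. -/
def Term.consts {U : Type*} {n : ℕ} : Term U n → Finset U
  | .var _ => ∅
  | .const c => {c}

/-- First-order formulas over the schema `τ`, with constants from `U`, whose free variables are
among `n` variables, listed in order (so `Φ = Φ(x₁, …, xₙ)`). A quantifier binds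
variable `0` of its body; variable `i` outside it is variable `i + 1` inside. -/
inductive Formula (τ : Schema) (U : Type*) : ℕ → Type _
  | rel {n : ℕ} (R : τ.Rel) (t : Fin (τ.arity R) → Term U n) : Formula τ U n
  | eq {n : ℕ} (s t : Term U n) : Formula τ U n
  | not {n : ℕ} (φ : Formula τ U n) : Formula τ U n
  | and {n : ℕ} (φ ψ : Formula τ U n) : Formula τ U n
  | or {n : ℕ} (φ ψ : Formula τ U n) : Formula τ U n
  | ex {n : ℕ} (φ : Formula τ U (n + 1)) : Formula τ U n
  | all {n : ℕ} (φ : Formula τ U (n + 1)) : Formula τ U n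

open scoped Classical in
/-- `adom(Φ)`: the constants appearing in a formula. -/
noncomputable def Formula.consts {τ : Schema} {U : Type*} : {n : ℕ} → Formula τ U n → Finset U
  | _, .rel _ t => Finset.univ.biUnion fun i => (t i).consts
  | _, .eq s t => s.consts ∪ t.consts
  | _, .not φ => φ.consts
  | _, .and φ ψ => φ.consts ∪ ψ.consts
  | _, .or φ ψ => φ.consts ∪ ψ.consts
  | _, .ex φ => φ.consts
  | _, .all φ => φ.consts

/-- Satisfaction of a formula in an instance `D`, with quantifiers ranging over the set `A`. -/
def Formula.SatOn {τ : Schema} {U : Type*} (D : Instance τ U) (A : Finset U) :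
    {n : ℕ} → Formula τ U n → (Fin n → U) → Prop
  | _, .rel R t, v => (⟨R, fun i => (t i).eval v⟩ : Fact τ U) ∈ D
  | _, .eq s t, v => s.eval v = t.eval v
  | _, .not φ, v => ¬ φ.SatOn D A v
  | _, .and φ ψ, v => φ.SatOn D A v ∧ ψ.SatOn D A v
  | _, .or φ ψ, v => φ.SatOn D A v ∨ ψ.SatOn D A v
  | _, .ex φ, v => ∃ a ∈ A, φ.SatOn D A (Fin.cons a v)
  | _, .all φ, v => ∀ a ∈ A, φ.SatOn D A (Fin.cons a v)

open scoped Classical in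
/-- `adom(D)`: the elements of the universe appearing among the facts of `D`. -/
noncomputable def Instance.adom {τ : Schema} {U : Type*} (D : Instance τ U) : Finset U :=
  D.biUnion fun f => Finset.univ.image f.2

open scoped Classical in
/-- `adom(D, Φ) = adom(D) ∪ adom(Φ)`. -/
noncomputable def Formula.adom {τ : Schema} {U : Type*} {n : ℕ} (D : Instance τ U)
    (φ : Formula τ U n) : Finset U :=
  Instance.adom D ∪ φ.consts

open scoped Classical in
/-- The tuples over `adom(D, Φ)` that satisfy `Φ` in `D` under the active domain semantics. -/
noncomputable def Formula.answers {τ : Schema} {U : Type*} {n : ℕ} (φ : Formula τ U n)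
    (D : Instance τ U) : Finset (Fin n → U) :=
  (Fintype.piFinset fun _ => φ.adom D).filter fun a => φ.SatOn D (φ.adom D) a

/-- A first-order view from schema `σ` to schema `τ`: for every relation symbol `R` of `τ`
a first-order formula over `σ` with `ar(R)` (ordered) free variables. -/
abbrev FOView (σ τ : Schema) (U : Type*) : Type _ :=
  (R : τ.Rel) → Formula σ U (τ.arity R)

/-- The instance that results from applying a first-order view to an instance. -/
noncomputable def FOView.apply {σ τ : Schema} {U : Type*} (V : FOView σ τ U)
    (D : Instance σ U) : Instance τ U :=
  Finset.univ.sigma fun R => (V R).answers D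

/-- A probabilistic database of schema `τ` over `U`: a discrete probability space whose sample
space is a set of `τ`-instances. (The sample space of a `PMF` is nonempty, and over a
countable universe there are only countably many instances.) -/
structure PDB (τ : Schema) (U : Type*) where
  /-- the sample space -/
  space : Set (Instance τ U)
  /-- the probability distribution -/
  P : PMF space

namespace PDB

variable {τ σ : Schema} {U : Type*}

/-- The probability that an instance drawn from the PDB has property `p`. -/
noncomputable def Pr (𝒟 : PDB τ U) (p : Instance τ U → Prop) : ENNReal :=
  𝒟.P.toOuterMeasure {D | p D.1}

/-- The possible worlds: the instances of positive probability. -/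
def worlds (𝒟 : PDB τ U) : Set (Instance τ U) :=
  Subtype.val '' 𝒟.P.support

/-- The facts appearing in some possible world. -/
def facts (𝒟 : PDB τ U) : Set (Fact τ U) :=
  {f | ∃ D ∈ 𝒟.worlds, f ∈ D}

/-- Tuple-independence: for any finitely many pairwise distinct facts of the PDB, the events that
they belong to the random instance have the product property. -/
def IsTI (𝒟 : PDB τ U) : Prop :=
  ∀ S : Finset (Fact τ U), (∀ f ∈ S, f ∈ 𝒟.facts) →
    𝒟.Pr (fun D => ∀ f ∈ S, f ∈ D) = ∏ f ∈ S, 𝒟.Pr (fun D => f ∈ D)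

/-- `𝒟` is the image of `ℐ` under the view `V`: `V` maps the sample space of `ℐ` to that of `𝒟`, and
the distribution of `𝒟` is the push-forward of that of `ℐ`. -/
def IsImage (𝒟 : PDB τ U) (V : Instance σ U → Instance τ U) (ℐ : PDB σ U) : Prop :=
  ∃ h : Set.MapsTo V ℐ.space 𝒟.space, ℐ.P.map h.restrict = 𝒟.P

/-- The class `FO(TI)`: images of tuple-independent PDBs (of any schema, over the same universe)
under first-order views. -/
def InFOTI (𝒟 : PDB τ U) : Prop :=
  ∃ (σ : Schema) (ℐ : PDB σ U) (V : FOView σ τ U), ℐ.IsTI ∧ 𝒟.IsImage V.apply ℐ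

/-- Bounded instance size: some fixed number bounds the size of all possible worlds. -/
def HasBoundedSize (𝒟 : PDB τ U) : Prop :=
  ∃ c : ℕ, ∀ D ∈ 𝒟.worlds, D.card ≤ c

end PDB

end ProbDB

/-! Instances with at most `c` facts can be coded by tuples of a fixed length `N`, so an `N`-ary
relation of independent "tickets" can name every possible world. If tickets have odds `r` and total
weight `W = totalWeight r`, then `{x}` is drawn with probability `r x / W`. Hence on the event of
exactly one ticket, worlds occur in any prescribed summable proportion. All other draws yield a
fallback world `a₀`, and the difficulty is not to give `a₀` too much mass.

Finitely many independent bits, stored as nullary facts, solve this. They either fix the world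
outright or, with a small probability `b`, pass the choice to the tickets. A finite set `T`
containing `a₀` carries nearly all mass: worlds of `T` are drawn by the bits, and a world `a`
outside `T` gets a ticket of odds `l * p a`, so it arises with probability `b * l * p a / W`. Taking
`b = W / l` makes this `p a`. With `l = 2 / p a₀` and a light tail, `W ≤ 2`, so `b ≤ p a₀` and the
fallback cannot overcharge `a₀`; its remaining mass comes from the bits (`exists_bits`,
`exists_lottery`).

The result is first-order: "exactly one ticket" and decoding are definable, and there are only
finitely many bit patterns (`definable_lotteryInstance`, `exists_view`). Summable odds make the
independent draw almost surely finite, so the tuple-independent PDB is an explicit normalized weight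
on finite sets (`tiPDB`). -/

namespace ProbDB

/-! ### First-order definability, independent of the quantifier range -/

section Definability

variable {σ τ : Schema} {U : Type*}

/-- The term `t` with its variables shifted under one quantifier. -/
def Term.lift {n : ℕ} : Term U n → Term U (n + 1)
  | .var i => .var i.succ
  | .const c => .const c

@[simp]
theorem Term.eval_lift {n : ℕ} (t : Term U n) (a : U) (v : Fin n → U) :
    t.lift.eval (Fin.cons a v : Fin (n + 1) → U) = t.eval v := by
  cases t <;> simp [Term.lift, Term.eval]

/-- A property of instances and valuations of `ι` is definable if every substitution of terms for
the elements of `ι` turns it into a property that is expressed by a formula, over all quantifier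
ranges that contain the active domain of the instance. -/
def Definable {ι : Type} (P : Instance σ U → (ι → U) → Prop) : Prop :=
  ∀ (n : ℕ) (t : ι → Term U n), ∃ φ : Formula σ U n, ∀ D A v, Instance.adom D ⊆ A →
    (φ.SatOn D A v ↔ P D fun i => (t i).eval v)

namespace Definable

variable {ι κ : Type} {P Q : Instance σ U → (ι → U) → Prop}

theorem congr (hP : Definable P) (h : ∀ D v, P D v ↔ Q D v) : Definable Q := by
  intro n t
  obtain ⟨φ, hφ⟩ := hP n t
  exact ⟨φ, fun D A v hA => (hφ D A v hA).trans (h _ _)⟩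

theorem rel (R : σ.Rel) :
    Definable fun (D : Instance σ U) (v : Fin (σ.arity R) → U) => (⟨R, v⟩ : Fact σ U) ∈ D :=
  fun _ t => ⟨.rel R t, fun _ _ _ _ => Iff.rfl⟩

theorem eq (i j : ι) : Definable fun (_ : Instance σ U) (v : ι → U) => v i = v j :=
  fun _ t => ⟨.eq (t i) (t j), fun _ _ _ _ => Iff.rfl⟩

theorem eq_const (i : ι) (c : U) : Definable fun (_ : Instance σ U) (v : ι → U) => v i = c :=
  fun _ t => ⟨.eq (t i) (.const c), fun _ _ _ _ => Iff.rfl⟩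

theorem not (hP : Definable P) : Definable fun D v => ¬ P D v := by
  intro n t
  obtain ⟨φ, hφ⟩ := hP n t
  exact ⟨.not φ, fun D A v hA => not_congr (hφ D A v hA)⟩

theorem and (hP : Definable P) (hQ : Definable Q) : Definable fun D v => P D v ∧ Q D v := by
  intro n t
  obtain ⟨φ, hφ⟩ := hP n t
  obtain ⟨ψ, hψ⟩ := hQ n t
  exact ⟨.and φ ψ, fun D A v hA => and_congr (hφ D A v hA) (hψ D A v hA)⟩

theorem or (hP : Definable P) (hQ : Definable Q) : Definable fun D v => P D v ∨ Q D v := by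
  intro n t
  obtain ⟨φ, hφ⟩ := hP n t
  obtain ⟨ψ, hψ⟩ := hQ n t
  exact ⟨.or φ ψ, fun D A v hA => or_congr (hφ D A v hA) (hψ D A v hA)⟩

theorem reindex (hP : Definable P) (f : ι → κ) :
    Definable fun (D : Instance σ U) (v : κ → U) => P D (v ∘ f) :=
  fun n t => hP n (t ∘ f)

theorem const [Nonempty U] (p : Prop) : Definable fun (_ : Instance σ U) (_ : ι → U) => p := by
  intro n t
  let c : U := Classical.arbitrary U
  by_cases h : p
  · exact ⟨.eq (.const c) (.const c), fun _ _ _ _ => iff_of_true rfl h⟩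
  · exact ⟨.not (.eq (.const c) (.const c)), fun _ _ _ _ => iff_of_false (fun h => h rfl) h⟩

theorem exists_finite [Nonempty U] {β : Type*} [Finite β]
    {P : β → Instance σ U → (ι → U) → Prop} (hP : ∀ b, Definable (P b)) :
    Definable fun D v => ∃ b, P b D v := by
  classical
  cases nonempty_fintype β
  have key : ∀ s : Finset β, Definable fun D v => ∃ b ∈ s, P b D v := by
    intro s
    induction s using Finset.induction with
    | empty => exact (const False).congr (by simp)
    | insert b s _ ih => exact ((hP b).or ih).congr (by simp)
  exact (key Finset.univ).congr (by simp)

theorem forall_finite [Nonempty U] {β : Type*} [Finite β]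
    {P : β → Instance σ U → (ι → U) → Prop} (hP : ∀ b, Definable (P b)) :
    Definable fun D v => ∀ b, P b D v :=
  (exists_finite fun b => (hP b).not).not.congr (by simp)

/-- Guarded existential quantification. -/
theorem ex {P : Instance σ U → (Option ι → U) → Prop} (hP : Definable P)
    (guard : ∀ D v, P D v → v none ∈ Instance.adom D) :
    Definable fun (D : Instance σ U) (v : ι → U) => ∃ a, P D fun o => o.elim a v := by
  intro n t
  obtain ⟨φ, hφ⟩ := hP (n + 1) fun o => o.elim (.var 0) fun i => (t i).lift
  refine ⟨.ex φ, fun D A v hA => ?_⟩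
  have key : ∀ a, (φ.SatOn D A (Fin.cons a v) ↔
      P D fun o => o.elim a fun i => (t i).eval v) := by
    intro a
    rw [hφ D A _ hA]
    have : (fun o : Option ι => Term.eval (Fin.cons a v : Fin (n + 1) → U)
        (o.elim (.var 0) fun i => (t i).lift)) = fun o => o.elim a fun i => (t i).eval v := by
      funext o
      cases o
      · rfl
      · simp
    rw [this]
  simp only [Formula.SatOn, key]
  -- The guard places every witness in the active domain of `D`, hence in `A`; this is why enlarging
  -- the range is harmless.
  exact ⟨fun ⟨a, _, h⟩ => ⟨a, h⟩, fun ⟨a, h⟩ => ⟨a, hA (guard _ _ h), h⟩⟩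

/-- Guarded existential quantification over tuples. -/
theorem ex_tuple : ∀ (k : ℕ) {ι : Type} {P : Instance σ U → (ι ⊕ Fin k → U) → Prop},
    Definable P → (∀ D v, P D v → ∀ i, v (.inr i) ∈ Instance.adom D) →
    Definable fun (D : Instance σ U) (v : ι → U) => ∃ x : Fin k → U, P D (Sum.elim v x)
  | 0, ι, P, hP, _ => by
    intro n t
    obtain ⟨φ, hφ⟩ := hP n (Sum.elim t Fin.elim0)
    refine ⟨φ, fun D A v hA => (hφ D A v hA).trans ?_⟩
    have : ∀ x : Fin 0 → U, Sum.elim (fun i => (t i).eval v) x =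
        fun i => Term.eval v (Sum.elim t Fin.elim0 i) := by
      intro x
      funext i
      rcases i with i | i
      · rfl
      · exact i.elim0
    simp [this]
  | k + 1, ι, P, hP, guard => by
    -- Coordinate `0` becomes the variable of the outer single quantifier; the others are left to
    -- the induction hypothesis.
    let f : ι ⊕ Fin (k + 1) → Option ι ⊕ Fin k :=
      Sum.elim (fun i => .inl (some i)) (Fin.cons (.inl none) fun j => .inr j)
    have h := ex (ex_tuple k (hP.reindex f) fun D v h i => by simpa [f] using guard _ _ h i.succ)
      fun D v ⟨x, h⟩ => by simpa [f] using guard _ _ h 0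
    refine h.congr fun D v => ?_
    rw [Fin.exists_fin_succ_pi]
    refine exists_congr fun a => exists_congr fun x => ?_
    have : Sum.elim (fun o : Option ι => o.elim a v) x ∘ f =
        Sum.elim v (Fin.cons a x : Fin (k + 1) → U) := by
      funext i
      rcases i with i | i
      · rfl
      · refine Fin.cases ?_ (fun j => ?_) i <;> simp [f]
    rw [this]

theorem mem_instance [Nonempty U] (D₀ : Instance τ U) (R : τ.Rel) :
    Definable fun (_ : Instance σ U) (a : Fin (τ.arity R) → U) => (⟨R, a⟩ : Fact τ U) ∈ D₀ := by
  have : Finite {b : Fin (τ.arity R) → U // (⟨R, b⟩ : Fact τ U) ∈ D₀} :=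
    Finite.of_injective (β := D₀) (fun b => ⟨⟨R, b.1⟩, b.2⟩) fun b b' h => by
      simpa [Subtype.ext_iff] using h
  refine (exists_finite fun b : {b : Fin (τ.arity R) → U // (⟨R, b⟩ : Fact τ U) ∈ D₀} =>
    forall_finite fun i => eq_const i (b.1 i)).congr fun D v => ?_
  constructor
  · rintro ⟨b, hb⟩
    rw [show v = b.1 from funext hb]
    exact b.2
  · exact fun h => ⟨⟨v, h⟩, fun _ => rfl⟩

end Definable

/-- Conjoining the tautologies `c = c` adds constants without changing the meaning. This lets a view
output elements that do not occur in its input. -/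
theorem Formula.exists_consts_subset {n : ℕ} (φ : Formula σ U n) (C : Finset U) :
    ∃ ψ : Formula σ U n, C ⊆ ψ.consts ∧ ∀ D A v, ψ.SatOn D A v ↔ φ.SatOn D A v := by
  classical
  induction C using Finset.induction with
  | empty => exact ⟨φ, by simp, fun _ _ _ => Iff.rfl⟩
  | insert c C _ ih =>
    obtain ⟨ψ, hC, hψ⟩ := ih
    refine ⟨.and (.eq (.const c) (.const c)) ψ, ?_, fun D A v => ?_⟩
    · intro a ha
      rcases Finset.mem_insert.1 ha with rfl | ha
      · simp [Formula.consts, Term.consts]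
      · simp [Formula.consts, Term.consts, hC ha]
    · simp [Formula.SatOn, hψ]

/-- A map between instances with definable relations is a first-order view if the elements that
it adds to the active domain come from a fixed finite set. -/
theorem exists_view (G : Instance σ U → Instance τ U)
    (hG : ∀ R, Definable fun D (a : Fin (τ.arity R) → U) => (⟨R, a⟩ : Fact τ U) ∈ G D)
    (C : Finset U) (hC : ∀ D, ∀ f ∈ G D, ∀ i, f.2 i ∈ Instance.adom D ∨ f.2 i ∈ C) :
    ∃ V : FOView σ τ U, V.apply = G := by
  classical
  have key : ∀ R, ∃ φ : Formula σ U (τ.arity R), C ⊆ φ.consts ∧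
      ∀ D A v, Instance.adom D ⊆ A → (φ.SatOn D A v ↔ (⟨R, v⟩ : Fact τ U) ∈ G D) := by
    intro R
    obtain ⟨φ, hφ⟩ := hG R _ Term.var
    obtain ⟨ψ, hψC, hψ⟩ := φ.exists_consts_subset C
    exact ⟨ψ, hψC, fun D A v hA => (hψ D A v).trans (hφ D A v hA)⟩
  choose V hVC hV using key
  refine ⟨V, funext fun D => ?_⟩
  ext ⟨R, a⟩
  have hA : Instance.adom D ⊆ (V R).adom D := by
    intro u hu
    simp [Formula.adom, hu]
  simp only [FOView.apply, Finset.mem_sigma, Finset.mem_univ, true_and, Formula.answers,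
    Finset.mem_filter, Fintype.mem_piFinset, hV R D _ a hA, and_iff_right_iff_imp]
  intro h i
  rcases hC D _ h i with h | h
  · exact hA h
  · simp [Formula.adom, hVC R h]

end Definability

/-! ### Independent random finite sets from summable odds -/

section Weights

open scoped ENNReal NNReal

variable {F : Type*}

/-- The unnormalized probability of a finite set if its elements are drawn independently,
where `r f` are the odds of `f`. -/
noncomputable def weight (r : F → ℝ≥0) (S : Finset F) : ℝ≥0∞ :=
  ∏ f ∈ S, (r f : ℝ≥0∞)

/-- The normalizing constant of `weight r`. -/
noncomputable def totalWeight (r : F → ℝ≥0) : ℝ≥0∞ :=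
  ∑' S, weight r S

theorem one_le_totalWeight (r : F → ℝ≥0) : 1 ≤ totalWeight r :=
  (by simp [weight] : (1 : ℝ≥0∞) ≤ weight r ∅).trans (ENNReal.le_tsum _)

theorem totalWeight_ne_zero (r : F → ℝ≥0) : totalWeight r ≠ 0 :=
  (zero_lt_one.trans_le (one_le_totalWeight r)).ne'

/-- Finitely many sets lie in the powerset of their union `T`, whose weights sum to `∏ (1 + r f) ≤
exp (∑ r f)`. -/
theorem totalWeight_le_exp (r : F → ℝ≥0) (x : ℝ≥0) (hx : ∑' f, (r f : ℝ≥0∞) ≤ x) :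
    totalWeight r ≤ ENNReal.ofReal (Real.exp x) := by
  classical
  rw [totalWeight, ENNReal.tsum_eq_iSup_sum]
  refine iSup_le fun 𝒮 => ?_
  set T : Finset F := 𝒮.biUnion id with hT
  have hsub : 𝒮 ⊆ T.powerset := fun S hS =>
    Finset.mem_powerset.2 (Finset.subset_biUnion_of_mem id hS)
  have hsum : (∑ f ∈ T, r f : ℝ≥0) ≤ x := by
    have := (ENNReal.sum_le_tsum (f := fun f => (r f : ℝ≥0∞)) T).trans hx
    exact_mod_cast this
  calc ∑ S ∈ 𝒮, weight r S ≤ ∑ S ∈ T.powerset, weight r S := Finset.sum_le_sum_of_subset hsub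
    _ = ((∏ f ∈ T, (1 + r f) : ℝ≥0) : ℝ≥0∞) := by
      rw [Finset.prod_one_add]
      push_cast
      rfl
    _ = ENNReal.ofReal (∏ f ∈ T, (1 + (r f : ℝ))) := by
      rw [← ENNReal.ofReal_coe_nnreal]
      push_cast
      rfl
    _ ≤ ENNReal.ofReal (Real.exp x) := by
      refine ENNReal.ofReal_le_ofReal ((Real.prod_one_add_le_exp_sum _ fun f => (r f).coe_nonneg).trans ?_)
      refine Real.exp_le_exp.2 ?_
      rw [← NNReal.coe_sum]
      exact_mod_cast hsum

theorem totalWeight_ne_top {r : F → ℝ≥0} (h : ∑' f, (r f : ℝ≥0∞) ≠ ∞) : totalWeight r ≠ ∞ := by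
  lift ∑' f, (r f : ℝ≥0∞) to ℝ≥0 using h with x hx
  exact ((totalWeight_le_exp r x hx.ge).trans_lt ENNReal.ofReal_lt_top).ne

theorem totalWeight_le_two {r : F → ℝ≥0} (h : ∑' f, (r f : ℝ≥0∞) ≤ 2⁻¹) : totalWeight r ≤ 2 := by
  refine (totalWeight_le_exp r 2⁻¹ (h.trans (by simp))).trans ?_
  rw [ENNReal.ofReal_le_iff_le_toReal (by simp)]
  -- `exp (1/2)` squares to `e < 4`, so it is below `2`.
  have h1 : Real.exp (2⁻¹ : ℝ) ^ 2 = Real.exp 1 := by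
    rw [← Real.exp_nat_mul]
    norm_num
  have h2 := Real.exp_one_lt_d9
  have h3 := Real.exp_pos (2⁻¹ : ℝ)
  push_cast
  simp only [ENNReal.toReal_ofNat]
  nlinarith

open scoped Classical in
/-- The total weight of the finite sets that contain `T`. -/
noncomputable def weightAbove (r : F → ℝ≥0) (T : Finset F) : ℝ≥0∞ :=
  ∑' S, if T ⊆ S then weight r S else 0

/-- Toggling `f` matches the sets above `insert f T` with those above `T` that miss `f`, and changes
weights by the factor `r f`. If the latter have weight `C`, the two sides are `r f * C * (1 + r f)`
and `r f * (r f * C + C)`. -/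
theorem weightAbove_insert [DecidableEq F] (r : F → ℝ≥0) {T : Finset F} {f : F} (hf : f ∉ T) :
    weightAbove r (insert f T) * (1 + r f) = r f * weightAbove r T := by
  classical
  let C : ℝ≥0∞ := ∑' S : Finset F, if T ⊆ S ∧ f ∉ S then weight r S else 0
  have h1 : weightAbove r (insert f T) = r f * C := by
    rw [weightAbove, ← ENNReal.tsum_mul_left]
    let e : Equiv.Perm (Finset F) :=
      (symmDiff_left_involutive ({f} : Finset F)).toPerm
    rw [← e.tsum_eq]
    refine tsum_congr fun S => ?_
    have he : e S = symmDiff S {f} := rfl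
    by_cases hS : f ∈ S
    · have : f ∉ e S := by simp [he, Finset.mem_symmDiff, hS]
      rw [if_neg fun h => this (h (Finset.mem_insert_self f T)), if_neg fun h => h.2 hS, mul_zero]
    · have heS : e S = insert f S := by
        ext g
        by_cases hg : g = f
        · simp [he, Finset.mem_symmDiff, hg, hS]
        · simp [he, Finset.mem_symmDiff, hg]
      have hT : T ⊆ insert f S ↔ T ⊆ S := Finset.subset_insert_iff_of_notMem hf
      rw [heS]
      simp [Finset.insert_subset_iff, hT, hS, weight]
  have h2 : weightAbove r T = r f * C + C := by
    rw [← h1, weightAbove, weightAbove, ← ENNReal.tsum_add]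
    refine tsum_congr fun S => ?_
    by_cases hT : T ⊆ S <;> by_cases hS : f ∈ S <;> simp [hT, hS, Finset.insert_subset_iff]
  rw [h2, h1]
  ring

/-- The product form is tuple-independence: odds `r f` correspond to the marginal `r f / (1 + r f)`.
-/
theorem weightAbove_div (r : F → ℝ≥0) (h : ∑' f, (r f : ℝ≥0∞) ≠ ∞) (T : Finset F) :
    weightAbove r T / totalWeight r = ∏ f ∈ T, (r f : ℝ≥0∞) / (1 + r f) := by
  classical
  induction T using Finset.induction with
  | empty =>
    rw [Finset.prod_empty]
    have : weightAbove r ∅ = totalWeight r := by simp [weightAbove, totalWeight]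
    rw [this, ENNReal.div_self (totalWeight_ne_zero r) (totalWeight_ne_top h)]
  | insert f T hf ih =>
    rw [Finset.prod_insert hf, ← ih]
    have h0 : (1 + r f : ℝ≥0∞) ≠ 0 := by simp
    have h1 : (1 + r f : ℝ≥0∞) ≠ ∞ := by simp
    have := weightAbove_insert r hf
    rw [(ENNReal.eq_div_iff h0 h1).2 ((mul_comm _ _).trans this)]
    simp only [div_eq_mul_inv]
    ring

theorem tsum_support_weight (r : F → ℝ≥0) :
    ∑' X : Function.support (weight r), weight r X.1 = totalWeight r :=
  tsum_subtype_eq_of_support_subset subset_rfl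

variable {σ : Schema} {U : Type*}

/-- The tuple-independent PDB where the odds of the facts are given by `r`. -/
noncomputable def tiPDB (r : Fact σ U → ℝ≥0) (h : ∑' f, (r f : ℝ≥0∞) ≠ ∞) : PDB σ U where
  space := Function.support (weight r)
  P := PMF.normalize (fun X : Function.support (weight r) => weight r X.1)
    ((tsum_support_weight r).symm ▸ totalWeight_ne_zero r)
    ((tsum_support_weight r).symm ▸ totalWeight_ne_top h)

variable (r : Fact σ U → ℝ≥0) (h : ∑' f, (r f : ℝ≥0∞) ≠ ∞)

theorem tiPDB_apply (X : (tiPDB r h).space) :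
    (tiPDB r h).P X = weight r X.1 / totalWeight r := by
  have h0 := (tsum_support_weight r).symm ▸ totalWeight_ne_zero r
  have h1 := (tsum_support_weight r).symm ▸ totalWeight_ne_top h
  refine (PMF.normalize_apply h0 h1 X).trans ?_
  rw [tsum_support_weight]
  rfl

theorem tiPDB_mem_support (X : (tiPDB r h).space) : X ∈ (tiPDB r h).P.support := by
  rw [PMF.mem_support_iff, tiPDB_apply]
  exact ENNReal.div_ne_zero.2 ⟨X.2, totalWeight_ne_top h⟩

theorem tiPDB_tsum (p : Instance σ U → Prop) [DecidablePred p] :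
    ∑' X : (tiPDB r h).space, (if p X.1 then (tiPDB r h).P X else 0) =
      (∑' X : Instance σ U, if p X then weight r X else 0) / totalWeight r := by
  rw [div_eq_mul_inv, ← ENNReal.tsum_mul_right]
  rw [← tsum_subtype_eq_of_support_subset (s := (tiPDB r h).space)]
  · refine tsum_congr fun X => ?_
    rw [tiPDB_apply]
    split_ifs <;> simp [div_eq_mul_inv]
  · intro X hX h0
    exact hX (by simp [h0])

theorem tiPDB_Pr (T : Finset (Fact σ U)) :
    (tiPDB r h).Pr (fun D => ∀ f ∈ T, f ∈ D) = weightAbove r T / totalWeight r := by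
  classical
  rw [PDB.Pr, PMF.toOuterMeasure_apply]
  simp only [Set.indicator_apply, Set.mem_ofPred_eq]
  rw [weightAbove]
  convert tiPDB_tsum r h fun D => T ⊆ D
  exact Iff.rfl

theorem tiPDB_isTI : (tiPDB r h).IsTI := by
  intro T _
  have h1 : ∀ f, (tiPDB r h).Pr (fun D => f ∈ D) = (r f : ℝ≥0∞) / (1 + r f) := by
    intro f
    have := tiPDB_Pr r h {f}
    rw [weightAbove_div r h, Finset.prod_singleton] at this
    simpa using this
  simp only [h1]
  rw [tiPDB_Pr, weightAbove_div r h]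

end Weights

/-! ### Realizing a discrete distribution by tickets and bits -/

section Lottery

open scoped ENNReal NNReal

theorem weight_disjSum {α β : Type*} (r : α ⊕ β → ℝ≥0) (S : Finset α) (T : Finset β) :
    weight r (S.disjSum T) = weight (r ∘ Sum.inl) S * weight (r ∘ Sum.inr) T :=
  Finset.prod_disjSum _ _ _

/-- Every finite distribution is the image of a finite family of independent bits. -/
theorem exists_bits {α : Type*} [DecidableEq α] [Nonempty α] (c : α → ℝ≥0) (s : Finset α) :
    ∃ (ι : Type) (_ : Fintype ι) (r : ι → ℝ≥0) (g : Finset ι → α), ∀ a,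
      (∑ S, if g S = a then weight r S else 0) * ∑ b ∈ s, (c b : ℝ≥0∞) =
        (if a ∈ s then (c a : ℝ≥0∞) else 0) * ∑ S, weight r S := by
  induction s using Finset.induction with
  | empty => exact ⟨Empty, inferInstance, fun _ => 0, fun _ => Classical.arbitrary α, by simp⟩
  | insert b s hb ih =>
    obtain ⟨ι, _, r, g, hg⟩ := ih
    set C : ℝ≥0∞ := ∑ b ∈ s, (c b : ℝ≥0∞) with hC
    rw [Finset.sum_insert hb, ← hC]
    by_cases hC0 : C = 0
    -- Only `b` can have mass here, so a constant result suffices.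
    · refine ⟨Empty, inferInstance, fun _ => 0, fun _ => b, fun a => ?_⟩
      have hs : ∀ a ∈ s, (c a : ℝ≥0∞) = 0 := Finset.sum_eq_zero_iff.1 hC0
      rw [hC0]
      by_cases hab : b = a
      · subst hab
        simp [mul_comm]
      · by_cases has : a ∈ s
        · simp [hab, has, hs a has]
        · simp [hab, has, Ne.symm hab]
    · have hCt : C ≠ ∞ := ENNReal.sum_ne_top.2 fun _ _ => ENNReal.coe_ne_top
      -- One new bit decides between `b` and the old experiment; its odds must be the ratio of `c b`
      -- to the mass of `s`.
      let q : ℝ≥0 := c b / C.toNNReal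
      have hq : (q : ℝ≥0∞) * C = c b := by
        have h0 : C.toNNReal ≠ 0 := by simp [ENNReal.toNNReal_eq_zero_iff, hC0, hCt]
        conv_lhs => rw [← ENNReal.coe_toNNReal hCt]
        rw [← ENNReal.coe_mul, div_mul_cancel₀ _ h0]
      let r' : Unit ⊕ ι → ℝ≥0 := Sum.elim (fun _ => q) r
      let g' : Finset (Unit ⊕ ι) → α := fun S => if () ∈ S.toLeft then b else g S.toRight
      have hsum : ∀ (p : α → Prop) [DecidablePred p], (∑ S, if p (g' S) then weight r' S else 0) =
          (if p b then q * ∑ S, weight r S else 0) + ∑ S, if p (g S) then weight r S else 0 := by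
        intro p _
        rw [← Finset.sumEquiv.toEquiv.symm.sum_comp, Fintype.sum_prod_type,
          show (Finset.univ : Finset (Finset Unit)) = {{()}, ∅} by decide, Finset.sum_pair (by simp)]
        congr 1
        · split_ifs with hp
          · rw [Finset.mul_sum]
            refine Finset.sum_congr rfl fun S _ => ?_
            have : Finset.sumEquiv.toEquiv.symm (({()} : Finset Unit), S) =
              Finset.disjSum {()} S := rfl
            rw [this, weight_disjSum]
            simp only [g', Finset.toLeft_disjSum, Finset.mem_singleton, if_true, hp]
            simp [weight, r']
          · refine Finset.sum_eq_zero fun S _ => ?_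
            have : Finset.sumEquiv.toEquiv.symm (({()} : Finset Unit), S) =
              Finset.disjSum {()} S := rfl
            rw [this]
            simp [g', hp]
        · refine Finset.sum_congr rfl fun S _ => ?_
          have : Finset.sumEquiv.toEquiv.symm ((∅ : Finset Unit), S) =
            Finset.disjSum ∅ S := rfl
          rw [this, weight_disjSum]
          simp only [g', Finset.toLeft_disjSum, Finset.toRight_disjSum, Finset.notMem_empty, if_false]
          simp [weight, r']
      refine ⟨Unit ⊕ ι, inferInstance, r', g', fun a => ?_⟩
      have htot := hsum fun _ => True
      simp only [if_true] at htot
      rw [htot, hsum fun x => x = a]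
      by_cases hab : b = a
      · subst hab
        -- The old experiment yields `b` with weight zero, since `b ∉ s`.
        have := hg b
        rw [if_neg hb, zero_mul, mul_eq_zero, or_iff_left hC0] at this
        rw [this, if_pos rfl, if_pos (Finset.mem_insert_self _ _), add_zero, ← hq]
        ring
      · have h2 : (if a ∈ insert b s then (c a : ℝ≥0∞) else 0) =
            if a ∈ s then (c a : ℝ≥0∞) else 0 := by
          simp [Finset.mem_insert, Ne.symm hab]
        rw [if_neg hab, zero_add, h2, ← hq]
        calc _ = ((∑ S, if g S = a then weight r S else 0) * C) * (q + 1) := by ring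
          _ = _ := by
            rw [hg a]
            ring

open scoped Classical in
/-- The result of a lottery: the set `S` of bits either determines the result, or leaves the
decision to the set `E` of tickets. If this is no single ticket then the result is `a₀`. -/
noncomputable def lotteryResult {α X ι : Type*} (dec : X → α) (g : Finset ι → Option α) (a₀ : α)
    (E : Finset X) (S : Finset ι) : α :=
  match g S with
  | some a => a
  | none => if h : ∃ x, E = {x} then dec h.choose else a₀

section

variable {α X ι : Type*} {dec : X → α} {g : Finset ι → Option α} {a₀ : α} {S : Finset ι}

theorem lotteryResult_some {a : α} (h : g S = some a) (E : Finset X) :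
    lotteryResult dec g a₀ E S = a := by
  simp [lotteryResult, h]

theorem lotteryResult_singleton (h : g S = none) (x : X) :
    lotteryResult dec g a₀ {x} S = dec x := by
  have hx : ∃ y, ({x} : Finset X) = {y} := ⟨x, rfl⟩
  have : hx.choose = x := (Finset.singleton_injective hx.choose_spec).symm
  simp only [lotteryResult, h]
  rw [dif_pos hx, this]

theorem lotteryResult_not_singleton (h : g S = none) {E : Finset X} (hE : ¬ ∃ x, E = {x}) :
    lotteryResult dec g a₀ E S = a₀ := by
  simp only [lotteryResult, h]
  rw [dif_neg hE]

open scoped Classical in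
-- Since `a` is not the fallback, only one-element ticket sets contribute, and `{x}` has weight `r
-- x`.
theorem tsum_lotteryResult_none (h : g S = none) (r : X → ℝ≥0) {a : α} (ha : a ≠ a₀) :
    (∑' E, if lotteryResult dec g a₀ E S = a then weight r E else 0) =
      ∑' x, if dec x = a then (r x : ℝ≥0∞) else 0 := by
  rw [← Finset.singleton_injective.tsum_eq]
  · refine tsum_congr fun x => ?_
    simp [lotteryResult_singleton h, weight]
  · intro E hE
    by_contra hn
    refine hE (if_neg ?_)
    rw [lotteryResult_not_singleton h fun ⟨x, hx⟩ => hn ⟨x, hx.symm⟩]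
    exact ha.symm

end

open scoped Classical in
-- Many tickets may decode to the same `a`; all odds go to the chosen code `enc a`, so nothing is
-- counted twice.
theorem tsum_tickets {α X : Type*} (dec : X → α) (enc : α → X) (s : α → ℝ≥0)
    (henc : ∀ a, s a ≠ 0 → dec (enc a) = a) (a : α) :
    (∑' x, if dec x = a then
      ((if x = enc (dec x) then s (dec x) else 0 : ℝ≥0) : ℝ≥0∞) else 0) = s a := by
  rw [tsum_eq_single (enc a)]
  · by_cases h : s a = 0
    · by_cases h' : dec (enc a) = a <;> simp [h', h]
    · simp [henc a h]
  · intro x hx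
    by_cases h : dec x = a
    · subst h
      simp [hx]
    · simp [h]

/-- Spares computing the probability of the fallback: it is forced by the total mass. -/
theorem eq_of_tsum_eq {α : Type*} {f g : α → ℝ≥0∞} (a₀ : α) (hg : ∑' a, g a ≠ ∞)
    (h : ∑' a, f a = ∑' a, g a) (hfg : ∀ a, a ≠ a₀ → f a = g a) (a : α) : f a = g a := by
  classical
  by_cases ha : a = a₀
  · subst ha
    rw [ENNReal.tsum_eq_add_tsum_ite a, ENNReal.tsum_eq_add_tsum_ite (f := g) a] at h
    rw [ENNReal.tsum_eq_add_tsum_ite a] at hg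
    have : (∑' x, if x = a then 0 else f x) = ∑' x, if x = a then 0 else g x :=
      tsum_congr fun x => by split_ifs with hx <;> simp [hfg _, hx]
    rw [this] at h
    exact (ENNReal.add_left_inj (ENNReal.add_ne_top.1 hg).2).1 h
  · exact hfg a ha

theorem exists_finset_tsum_compl_le {α : Type*} (p : PMF α) (a₀ : α) {ε : ℝ≥0∞} (hε : 0 < ε) :
    ∃ T : Finset α, a₀ ∈ T ∧ ∑' a : {a // a ∉ T}, p a ≤ ε := by
  have h := ENNReal.tendsto_tsum_compl_atTop_zero p.tsum_coe_ne_top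
  obtain ⟨T, hT, hT'⟩ := ((h.eventually (ge_mem_nhds hε)).and
    (Filter.eventually_ge_atTop {a₀})).exists
  exact ⟨T, by simpa using hT', hT⟩

open scoped Classical in
theorem tsum_tsum_lotteryResult {α X ι : Type*} [Fintype ι] (dec : X → α)
    (g : Finset ι → Option α) (a₀ : α) (rX : X → ℝ≥0) (rι : ι → ℝ≥0) {a : α} (ha : a ≠ a₀) :
    (∑' S, ∑' E, if lotteryResult dec g a₀ E S = a then weight rX E * weight rι S else 0) =
      (∑ S, if g S = some a then weight rι S else 0) * totalWeight rX +
      (∑ S, if g S = none then weight rι S else 0) *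
        ∑' x, if dec x = a then (rX x : ℝ≥0∞) else 0 := by
  rw [tsum_fintype, Finset.sum_mul, Finset.sum_mul, ← Finset.sum_add_distrib]
  refine Finset.sum_congr rfl fun S _ => ?_
  rcases hS : g S with _ | b
  · simp only [reduceCtorEq, if_false, zero_mul, zero_add, if_true]
    rw [← tsum_lotteryResult_none hS rX ha, ← ENNReal.tsum_mul_left]
    refine tsum_congr fun E => ?_
    split_ifs <;> simp [mul_comm]
  · simp only [lotteryResult_some hS, Option.some.injEq, reduceCtorEq, if_false, zero_mul, add_zero]
    by_cases hb : b = a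
    · simp only [hb, if_true]
      rw [ENNReal.tsum_mul_right, mul_comm]
      rfl
    · simp [hb]

open scoped Classical in
/-- Every discrete distribution is the distribution of the result of a lottery. -/
theorem exists_lottery {α X : Type*} (p : PMF α) (dec : X → α)
    (hdec : ∀ a ∈ p.support, ∃ x, dec x = a) :
    ∃ (ι : Type) (_ : Fintype ι) (rX : X → ℝ≥0) (rι : ι → ℝ≥0) (g : Finset ι → Option α) (a₀ : α),
      ∑' x, (rX x : ℝ≥0∞) ≠ ∞ ∧
      ∀ a, (∑' S, ∑' E, if lotteryResult dec g a₀ E S = a then weight rX E * weight rι S else 0) =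
        p a * (totalWeight rX * totalWeight rι) := by
  obtain ⟨a₀, ha₀⟩ := p.support_nonempty
  have : Nonempty X := let ⟨x, _⟩ := hdec a₀ ha₀; ⟨x⟩
  have hdec' : ∀ a, ∃ x, p a ≠ 0 → dec x = a := by
    intro a
    by_cases h : p a = 0
    · exact ⟨Classical.arbitrary X, fun h' => absurd h h'⟩
    · obtain ⟨x, hx⟩ := hdec a ((p.mem_support_iff a).2 h)
      exact ⟨x, fun _ => hx⟩
  choose enc henc using hdec'
  let P : α → ℝ≥0 := fun a => (p a).toNNReal
  have hP : ∀ a, (P a : ℝ≥0∞) = p a := fun a => ENNReal.coe_toNNReal (p.apply_ne_top a)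
  have hP0 : P a₀ ≠ 0 := by
    rw [← ENNReal.coe_ne_zero, hP]
    exact (p.mem_support_iff a₀).1 ha₀
  have hPpos : 0 < P a₀ := pos_iff_ne_zero.2 hP0
  let l : ℝ≥0 := 2 / P a₀
  have hl : l ≠ 0 := by positivity
  -- The tail bound `P a₀ / 4` times `l = 2 / P a₀` is `1/2`, the bound that `totalWeight_le_two`
  -- needs.
  obtain ⟨T, ha₀T, hT⟩ := exists_finset_tsum_compl_le p a₀
    (ε := ((P a₀ / 4 : ℝ≥0) : ℝ≥0∞)) (by rw [ENNReal.coe_pos]; positivity)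
  let s : α → ℝ≥0 := fun a => if a ∈ T then 0 else l * P a
  have hs : ∀ a, s a ≠ 0 → dec (enc a) = a := by
    intro a h
    refine henc a fun h0 => h ?_
    simp [s, P, h0]
  let rX : X → ℝ≥0 := fun x => if x = enc (dec x) then s (dec x) else 0
  have hr : ∀ a, (∑' x, if dec x = a then (rX x : ℝ≥0∞) else 0) = s a := tsum_tickets dec enc s hs
  have hrsum : ∑' x, (rX x : ℝ≥0∞) ≤ 2⁻¹ := by
    calc ∑' x, (rX x : ℝ≥0∞) = ∑' x, ∑' a, if dec x = a then (rX x : ℝ≥0∞) else 0 :=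
          tsum_congr fun x => by rw [tsum_eq_single (dec x) (by simp +contextual [eq_comm])]; simp
      _ = ∑' a, (s a : ℝ≥0∞) := by
          rw [ENNReal.tsum_comm]
          exact tsum_congr hr
      _ = ∑' a : {a | a ∉ T}, (s a : ℝ≥0∞) := by
          refine (tsum_subtype_eq_of_support_subset (f := fun a => (s a : ℝ≥0∞)) ?_).symm
          intro a ha h
          exact ha (by simp [s, show a ∈ T by simpa using h])
      _ = ∑' a : {a // a ∉ T}, l * p a := by
          refine tsum_congr fun a => ?_
          have : a.1 ∉ T := a.2
          simp [s, this, hP]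
      _ ≤ l * ((P a₀ / 4 : ℝ≥0) : ℝ≥0∞) := by
          rw [ENNReal.tsum_mul_left]
          exact mul_le_mul_right hT _
      _ = 2⁻¹ := by
          rw [← ENNReal.coe_mul, show l * (P a₀ / 4) = 2⁻¹ by simp only [l]; field_simp; norm_num]
          simp
  have hrtop : ∑' x, (rX x : ℝ≥0∞) ≠ ∞ := (hrsum.trans_lt (by simp)).ne
  set W : ℝ≥0 := (totalWeight rX).toNNReal
  have hW : (W : ℝ≥0∞) = totalWeight rX := ENNReal.coe_toNNReal (totalWeight_ne_top hrtop)
  have hW2 : W ≤ 2 := by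
    have := totalWeight_le_two hrsum
    rw [← hW] at this
    exact_mod_cast this
  let b : ℝ≥0 := W / l
  have hb : b ≤ P a₀ := by
    calc W / l ≤ 2 / l := by gcongr
      _ = P a₀ := by simp only [l]; field_simp
  -- Distribution for the bits: `none` defers to the tickets, and `a₀` takes what remains. The
  -- truncated subtraction is exact by `hPT`.
  let c : Option α → ℝ≥0 := fun o => o.elim b fun a =>
    if a = a₀ then 1 - b - ∑ a ∈ T.erase a₀, P a else P a
  have hPT : b + ∑ a ∈ T.erase a₀, P a ≤ 1 := by
    calc b + ∑ a ∈ T.erase a₀, P a ≤ P a₀ + ∑ a ∈ T.erase a₀, P a := by gcongr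
      _ = ∑ a ∈ T, P a := Finset.add_sum_erase T P ha₀T
      _ ≤ 1 := by
        rw [← ENNReal.coe_le_coe, ENNReal.ofNNReal_finsetSum]
        simp only [hP]
        exact (ENNReal.sum_le_tsum T).trans p.tsum_coe.le
  have hc : ∑ o ∈ T.insertNone, (c o : ℝ≥0∞) = 1 := by
    rw [Finset.sum_insertNone, ← Finset.add_sum_erase T _ ha₀T]
    have : ∑ a ∈ T.erase a₀, (c (some a) : ℝ≥0∞) = (∑ a ∈ T.erase a₀, P a : ℝ≥0) := by
      rw [ENNReal.ofNNReal_finsetSum]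
      exact Finset.sum_congr rfl fun a ha => by simp [c, Finset.ne_of_mem_erase ha]
    rw [this]
    simp only [c, Option.elim_none, Option.elim_some, if_true]
    rw [← ENNReal.coe_add, ← ENNReal.coe_add, ← ENNReal.coe_one, ENNReal.coe_inj, tsub_tsub,
      ← add_assoc, add_right_comm, add_tsub_cancel_of_le hPT]
  obtain ⟨ι, _, rι, g, hg⟩ := exists_bits c T.insertNone
  simp only [hc, mul_one] at hg
  have hι : totalWeight rι = ∑ S, weight rι S := tsum_fintype _
  have hιtop : totalWeight rι ≠ ∞ := totalWeight_ne_top (by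
    rw [tsum_fintype]; exact ENNReal.sum_ne_top.2 fun _ _ => ENNReal.coe_ne_top)
  refine ⟨ι, inferInstance, rX, rι, g, a₀, hrtop, ?_⟩
  refine eq_of_tsum_eq a₀ ?_ ?_ fun a ha => ?_
  · rw [ENNReal.tsum_mul_right, p.tsum_coe, one_mul]
    exact ENNReal.mul_ne_top (totalWeight_ne_top hrtop) hιtop
  · rw [ENNReal.tsum_mul_right, p.tsum_coe, one_mul, ENNReal.tsum_comm]
    calc _ = ∑' S, ∑' E, weight rX E * weight rι S := by
          refine tsum_congr fun S => ?_
          rw [ENNReal.tsum_comm]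
          refine tsum_congr fun E => ?_
          rw [tsum_eq_single (lotteryResult dec g a₀ E S) (by simp +contextual [eq_comm])]
          simp
      _ = _ := by
          simp only [ENNReal.tsum_mul_right, ENNReal.tsum_mul_left]
          rfl
  · rw [tsum_tsum_lotteryResult dec g a₀ rX rι ha, hr, hg, hg, ← hι, ← hW]
    by_cases haT : a ∈ T
    · simp only [Finset.some_mem_insertNone, haT, if_true, s, c, Option.elim_some, ha, if_false, hP]
      simp only [ENNReal.coe_zero, mul_zero, add_zero]
      ring
    · simp only [Finset.some_mem_insertNone, haT, if_false, zero_mul, zero_add,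
        Finset.none_mem_insertNone, if_true, s, c, Option.elim_none, ENNReal.coe_mul, hP]
      -- The choice of `b` cancels the normalization `W` of the ticket draw.
      have : (b : ℝ≥0∞) * l = W := by
        rw [← ENNReal.coe_mul, div_mul_cancel₀ _ hl]
      rw [← this]
      ring

end Lottery

/-! ### Coding bounded instances by tuples -/

section Encoding

variable {σ τ : Schema} {U : Type*}

/-- The positions of tuples that encode instances of size at most `c`. -/
abbrev Slot (τ : Schema) (c : ℕ) : Type :=
  Fin c × (τ.Rel ⊕ Σ R : τ.Rel, Fin (τ.arity R))

noncomputable instance (τ : Schema) (c : ℕ) : Fintype (Slot τ c) :=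
  Fintype.ofFinite _

open scoped Classical in
/-- The instance encoded by `x`, where the element `u` flags the facts that are present. -/
noncomputable def decode {c : ℕ} (u : U) (x : Slot τ c → U) : Instance τ U :=
  (Finset.univ.filter fun s : Fin c × τ.Rel => x (s.1, .inl s.2) = u).image fun s =>
    ⟨s.2, fun i => x (s.1, .inr ⟨s.2, i⟩)⟩

theorem mem_decode {c : ℕ} {u : U} {x : Slot τ c → U} {R : τ.Rel} {a : Fin (τ.arity R) → U} :
    (⟨R, a⟩ : Fact τ U) ∈ decode u x ↔
      ∃ j, x (j, .inl R) = u ∧ ∀ i, x (j, .inr ⟨R, i⟩) = a i := by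
  simp only [decode, Finset.mem_image, Finset.mem_filter, Finset.mem_univ, true_and, Prod.exists]
  constructor
  · rintro ⟨j, R', h, h'⟩
    obtain ⟨rfl, h'⟩ := Sigma.mk.inj_iff.1 h'
    exact ⟨j, h, congr_fun (eq_of_heq h')⟩
  · rintro ⟨j, h, h'⟩
    exact ⟨j, R, h, by rw [funext h']⟩

theorem exists_decode_eq [Nontrivial U] {c : ℕ} (u : U) (D : Instance τ U) (hD : D.card ≤ c) :
    ∃ x : Slot τ c → U, decode u x = D := by
  -- Row `j` stores the `j`-th fact of a list of `D`; rows past the end have `g j = none`, so all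
  -- their flags are `u' ≠ u`.
  classical
  obtain ⟨u', hu'⟩ := exists_ne u
  let g : Fin c → Option (Fact τ U) := fun j => D.toList[j.1]?
  have hg : ∀ f, f ∈ D ↔ ∃ j, g j = some f := by
    intro f
    rw [← Finset.mem_toList, List.mem_iff_getElem?]
    constructor
    · rintro ⟨j, hj⟩
      have hj' := (List.getElem?_eq_some_iff.1 hj).1
      rw [Finset.length_toList] at hj'
      exact ⟨⟨j, hj'.trans_le hD⟩, hj⟩
    · rintro ⟨j, hj⟩
      exact ⟨j, hj⟩
  refine ⟨fun s => s.2.elim (fun R => if ∃ a, g s.1 = some ⟨R, a⟩ then u else u') fun p =>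
    if h : ∃ a : Fin (τ.arity p.1) → U, g s.1 = some ⟨p.1, a⟩ then h.choose p.2 else u, ?_⟩
  ext ⟨R, a⟩
  rw [mem_decode, hg]
  refine exists_congr fun j => ?_
  simp only [Sum.elim_inl, Sum.elim_inr]
  by_cases h : ∃ b, g j = some ⟨R, b⟩
  · simp only [if_pos h, dif_pos h, true_and]
    rw [← funext_iff]
    constructor
    · rintro rfl
      exact h.choose_spec
    · intro ha
      simpa using h.choose_spec.symm.trans ha
  · simp only [if_neg h, hu', false_and, false_iff]
    exact fun h' => h ⟨a, h'⟩

theorem definable_decode [Nonempty U] {c : ℕ} (u : U) (R : τ.Rel) :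
    Definable fun (_ : Instance σ U) (v : Fin (τ.arity R) ⊕ Slot τ c → U) =>
      (⟨R, v ∘ Sum.inl⟩ : Fact τ U) ∈ decode u (v ∘ Sum.inr) := by
  refine (Definable.exists_finite fun j : Fin c =>
    (Definable.eq_const (.inr (j, .inl R)) u).and (Definable.forall_finite fun i =>
      Definable.eq (.inr (j, .inr ⟨R, i⟩)) (.inl i))).congr fun _ v => ?_
  rw [mem_decode]
  rfl

/-- Instances of bounded size can be encoded by tuples of some fixed length. -/
theorem exists_encoding [Infinite U] (τ : Schema) (c : ℕ) :
    ∃ (N : ℕ) (dec : (Fin N → U) → Instance τ U), (∀ D, D.card ≤ c → ∃ x, dec x = D) ∧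
      (∀ x, ∀ f ∈ dec x, ∀ i, ∃ k, x k = f.2 i) ∧
      ∀ (σ : Schema) (R : τ.Rel), Definable
        fun (_ : Instance σ U) (v : Fin (τ.arity R) ⊕ Fin N → U) =>
          (⟨R, v ∘ Sum.inl⟩ : Fact τ U) ∈ dec (v ∘ Sum.inr) := by
  let u : U := Classical.arbitrary U
  let e := Fintype.equivFin (Slot τ c)
  refine ⟨_, fun x => decode u (x ∘ e), fun D hD => ?_, fun x ⟨R, a⟩ hf i => ?_, fun σ R => ?_⟩
  · obtain ⟨x, hx⟩ := exists_decode_eq u D hD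
    exact ⟨x ∘ e.symm, by simpa [Function.comp_assoc] using hx⟩
  · obtain ⟨j, -, h⟩ := mem_decode.1 hf
    exact ⟨_, h i⟩
  · exact (definable_decode u R).reindex (Sum.map id e)

end Encoding

/-! ### The lottery as a first-order view -/

section LotteryView

variable {τ : Schema} {U : Type*} {N : ℕ} {ι : Type} [Fintype ι]

/-- The schema of lotteries: an `N`-ary relation of tickets, and nullary relations for bits. -/
def lotterySchema (N : ℕ) (ι : Type) [Fintype ι] : Schema where
  Rel := Option ι
  arity o := o.elim N fun _ => 0

/-- The fact that the ticket `x` is present. -/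
def ticketFact (ι : Type) [Fintype ι] (x : Fin N → U) : Fact (lotterySchema N ι) U :=
  ⟨(none : Option ι), x⟩

/-- The fact that the bit `i` is set. -/
def bitFact (N : ℕ) (U : Type*) (i : ι) : Fact (lotterySchema N ι) U :=
  ⟨(some i : Option ι), Fin.elim0⟩

/-- The facts of a lottery are its tickets and its bits. -/
def lotteryFactEquiv (N : ℕ) (ι : Type) [Fintype ι] (U : Type*) :
    (Fin N → U) ⊕ ι ≃ Fact (lotterySchema N ι) U where
  toFun := Sum.elim (ticketFact ι) (bitFact N U)
  invFun
    | ⟨none, x⟩ => .inl x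
    | ⟨some i, _⟩ => .inr i
  left_inv := by rintro (x | i) <;> rfl
  right_inv := by
    rintro ⟨_ | i, x⟩
    · rfl
    · exact congrArg (Sigma.mk (some i : Option ι)) (funext fun j => j.elim0)

/-- The tickets and bits of an instance. -/
def lotteryEquiv (N : ℕ) (ι : Type) [Fintype ι] (U : Type*) :
    Instance (lotterySchema N ι) U ≃ Finset (Fin N → U) × Finset ι :=
  (lotteryFactEquiv N ι U).symm.finsetCongr.trans Finset.sumEquiv.toEquiv

theorem mem_lotteryEquiv_fst (X : Instance (lotterySchema N ι) U) (x : Fin N → U) :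
    x ∈ (lotteryEquiv N ι U X).1 ↔ ticketFact ι x ∈ X := by
  change x ∈ (Finset.map _ X).toLeft ↔ _
  rw [Finset.mem_toLeft, Finset.mem_map_equiv]
  rfl

theorem mem_lotteryEquiv_snd (X : Instance (lotterySchema N ι) U) (i : ι) :
    i ∈ (lotteryEquiv N ι U X).2 ↔ bitFact N U i ∈ X := by
  change i ∈ (Finset.map _ X).toRight ↔ _
  rw [Finset.mem_toRight, Finset.mem_map_equiv]
  rfl

/-- The result of the lottery that an instance describes. -/
noncomputable def lotteryInstance (dec : (Fin N → U) → Instance τ U)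
    (g : Finset ι → Option (Instance τ U)) (D₀ : Instance τ U)
    (X : Instance (lotterySchema N ι) U) : Instance τ U :=
  lotteryResult dec g D₀ (lotteryEquiv N ι U X).1 (lotteryEquiv N ι U X).2

theorem mem_adom_of_ticketFact {X : Instance (lotterySchema N ι) U} {x : Fin N → U}
    (hx : ticketFact ι x ∈ X) (k : Fin N) : x k ∈ Instance.adom X := by
  classical
  rw [Instance.adom, Finset.mem_biUnion]
  exact ⟨_, hx, Finset.mem_image.2 ⟨k, Finset.mem_univ _, rfl⟩⟩

theorem definable_ticketFact {κ : Type} (f : Fin N → κ) :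
    Definable fun (X : Instance (lotterySchema N ι) U) (v : κ → U) => ticketFact ι (v ∘ f) ∈ X :=
  (Definable.rel (σ := lotterySchema N ι) (none : Option ι)).reindex f

theorem definable_bitFact {κ : Type} (i : ι) :
    Definable fun (X : Instance (lotterySchema N ι) U) (_ : κ → U) => bitFact N U i ∈ X :=
  ((Definable.rel (σ := lotterySchema N ι) (some i : Option ι)).reindex
    (Fin.elim0 : Fin 0 → κ)).congr fun X _ =>
      iff_of_eq (congrArg (fun w => (⟨some i, w⟩ : Fact (lotterySchema N ι) U) ∈ X)
        (funext fun j => j.elim0))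

theorem definable_exists_singleton [Nonempty U] {κ : Type} :
    Definable fun (X : Instance (lotterySchema N ι) U) (_ : κ → U) =>
      ∃ x, (lotteryEquiv N ι U X).1 = {x} := by
  have h1 : Definable fun (X : Instance (lotterySchema N ι) U) (_ : κ → U) =>
      ∃ x : Fin N → U, ticketFact ι x ∈ X :=
    Definable.ex_tuple N (definable_ticketFact Sum.inr) fun X v h => mem_adom_of_ticketFact h
  -- Two distinct tickets are present; with `h1`, its negation says that there is exactly one.
  have h2 : Definable fun (X : Instance (lotterySchema N ι) U) (_ : κ → U) =>
      ∃ x y : Fin N → U, (ticketFact ι x ∈ X ∧ ticketFact ι y ∈ X) ∧ ∃ k, ¬ x k = y k :=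
    Definable.ex_tuple N (Definable.ex_tuple N
      (((definable_ticketFact fun k => .inl (.inr k)).and (definable_ticketFact Sum.inr)).and
        (Definable.exists_finite fun k => (Definable.eq (.inl (.inr k)) (.inr k)).not))
      fun X v h => mem_adom_of_ticketFact h.1.2)
      fun X v ⟨_, h⟩ => mem_adom_of_ticketFact h.1.1
  refine (h1.and h2.not).congr fun X _ => ?_
  simp only [Finset.eq_singleton_iff_unique_mem, mem_lotteryEquiv_fst]
  constructor
  · rintro ⟨⟨x, hx⟩, h⟩
    refine ⟨x, hx, fun y hy => ?_⟩
    by_contra hne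
    exact h ⟨y, x, ⟨hy, hx⟩, Function.ne_iff.1 hne⟩
  · rintro ⟨x, hx, h⟩
    refine ⟨⟨x, hx⟩, ?_⟩
    rintro ⟨y, z, ⟨hy, hz⟩, k, hk⟩
    exact hk (by rw [h y hy, h z hz])

/-- Replaces the choice in `lotteryResult` by an existential quantifier over tickets, which a
formula can express. -/
theorem mem_lotteryResult_none_iff {ι : Type} {dec : (Fin N → U) → Instance τ U}
    {g : Finset ι → Option (Instance τ U)} (D₀ : Instance τ U) {S : Finset ι} (hS : g S = none)
    (E : Finset (Fin N → U)) (f : Fact τ U) :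
    f ∈ lotteryResult dec g D₀ E S ↔
      ((∃ x, E = {x}) ∧ ∃ x, x ∈ E ∧ f ∈ dec x) ∨ (¬ (∃ x, E = {x}) ∧ f ∈ D₀) := by
  by_cases h : ∃ x, E = {x}
  · obtain ⟨x, rfl⟩ := h
    simp [lotteryResult_singleton hS]
  · simp [lotteryResult_not_singleton hS h, h]

theorem definable_lotteryInstance [Nonempty U] {dec : (Fin N → U) → Instance τ U} {R : τ.Rel}
    (hdef : Definable fun (_ : Instance (lotterySchema N ι) U)
      (v : Fin (τ.arity R) ⊕ Fin N → U) => (⟨R, v ∘ Sum.inl⟩ : Fact τ U) ∈ dec (v ∘ Sum.inr))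
    (g : Finset ι → Option (Instance τ U)) (D₀ : Instance τ U) :
    Definable fun (X : Instance (lotterySchema N ι) U) (a : Fin (τ.arity R) → U) =>
      (⟨R, a⟩ : Fact τ U) ∈ lotteryInstance dec g D₀ X := by
  classical
  have hS : ∀ S, Definable fun (X : Instance (lotterySchema N ι) U) (a : Fin (τ.arity R) → U) =>
      (⟨R, a⟩ : Fact τ U) ∈ lotteryResult dec g D₀ (lotteryEquiv N ι U X).1 S := by
    intro S
    rcases hS : g S with _ | D
    · have h : Definable fun (X : Instance (lotterySchema N ι) U) (a : Fin (τ.arity R) → U) =>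
          ∃ x : Fin N → U, ticketFact ι x ∈ X ∧ (⟨R, a⟩ : Fact τ U) ∈ dec x :=
        Definable.ex_tuple N ((definable_ticketFact Sum.inr).and hdef)
          fun X v h => mem_adom_of_ticketFact h.1
      refine ((definable_exists_singleton.and h).or
        (definable_exists_singleton.not.and (Definable.mem_instance D₀ R))).congr fun X a => ?_
      simp only [mem_lotteryResult_none_iff D₀ hS, mem_lotteryEquiv_fst]
    · exact (Definable.mem_instance D R).congr fun X a => by rw [lotteryResult_some hS]
  -- Finite case distinction over the exact set `S` of bits that are present.
  refine (Definable.exists_finite fun S : Finset ι => (Definable.forall_finite fun i : ι =>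
    show Definable fun (X : Instance (lotterySchema N ι) U) (_ : Fin (τ.arity R) → U) =>
      (bitFact N U i ∈ X ↔ i ∈ S) from ?_).and (hS S)).congr fun X a => ?_
  · by_cases hi : i ∈ S
    · exact (definable_bitFact i).congr fun X a => by simp [hi]
    · exact (definable_bitFact i).not.congr fun X a => by simp [hi]
  · simp only [← mem_lotteryEquiv_snd, ← Finset.ext_iff]
    simp [lotteryInstance]

open scoped Classical in
theorem exists_lottery_view [Nonempty U] {dec : (Fin N → U) → Instance τ U}
    (hdec : ∀ x, ∀ f ∈ dec x, ∀ i, ∃ k, x k = f.2 i)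
    (hdef : ∀ R, Definable fun (_ : Instance (lotterySchema N ι) U)
      (v : Fin (τ.arity R) ⊕ Fin N → U) => (⟨R, v ∘ Sum.inl⟩ : Fact τ U) ∈ dec (v ∘ Sum.inr))
    (g : Finset ι → Option (Instance τ U)) (D₀ : Instance τ U) :
    ∃ V : FOView (lotterySchema N ι) τ U, V.apply = lotteryInstance dec g D₀ := by
  -- Output elements not taken from a ticket come from `D₀` or from one of the finitely many
  -- instances fixed by bits.
  refine exists_view _ (fun R => definable_lotteryInstance (hdef R) g D₀)
    (Instance.adom D₀ ∪ Finset.univ.biUnion fun S => Instance.adom ((g S).getD ∅)) ?_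
  have hadom : ∀ (D : Instance τ U), ∀ f ∈ D, ∀ i, f.2 i ∈ Instance.adom D := fun D f hf i =>
    Finset.mem_biUnion.2 ⟨f, hf, Finset.mem_image_of_mem _ (Finset.mem_univ i)⟩
  intro X f hf i
  rw [lotteryInstance] at hf
  rcases hS : g (lotteryEquiv N ι U X).2 with _ | D
  · rcases (mem_lotteryResult_none_iff D₀ hS _ f).1 hf with ⟨-, x, hx, hfx⟩ | ⟨-, hf₀⟩
    · obtain ⟨k, hk⟩ := hdec x f hfx i
      rw [← hk]
      exact .inl (mem_adom_of_ticketFact ((mem_lotteryEquiv_fst X x).1 hx) k)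
    · exact .inr (Finset.mem_union_left _ (hadom _ f hf₀ i))
  · rw [lotteryResult_some hS] at hf
    refine .inr (Finset.mem_union_right _ (Finset.mem_biUnion.2
      ⟨(lotteryEquiv N ι U X).2, Finset.mem_univ _, ?_⟩))
    rw [hS]
    exact hadom D f hf i

end LotteryView

/-! ### Push-forward of the lottery distribution -/

section Image

open scoped ENNReal NNReal

variable {σ τ : Schema} {U : Type*}

theorem pmf_map_val_apply {α : Type*} {s : Set α} (p : PMF s) (a : s) :
    p.map Subtype.val a.1 = p a := by
  classical
  rw [PMF.map_apply, tsum_eq_single a]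
  · simp
  · intro b hb
    rw [if_neg fun h => hb (Subtype.ext h.symm)]

theorem PDB.mem_worlds_iff {𝒟 : PDB τ U} {D : Instance τ U} :
    D ∈ 𝒟.worlds ↔ D ∈ (𝒟.P.map Subtype.val).support := by
  rw [PMF.support_map]
  rfl

/-- Full support of `ℐ` turns equality of distributions into `MapsTo` on the whole sample space. -/
theorem PDB.isImage_of_map_eq {𝒟 : PDB τ U} {ℐ : PDB σ U} {V : Instance σ U → Instance τ U}
    (hℐ : ∀ X, X ∈ ℐ.P.support)
    (h : ℐ.P.map (fun X => V X.1) = 𝒟.P.map Subtype.val) : 𝒟.IsImage V ℐ := by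
  have hV : Set.MapsTo V ℐ.space 𝒟.space := by
    intro X hX
    have : V X ∈ (𝒟.P.map Subtype.val).support := by
      rw [← h, PMF.support_map]
      exact ⟨⟨X, hX⟩, hℐ _, rfl⟩
    rw [PMF.support_map] at this
    obtain ⟨D, -, hD⟩ := this
    exact hD ▸ D.2
  refine ⟨hV, PMF.ext fun D => ?_⟩
  rw [← pmf_map_val_apply, ← pmf_map_val_apply 𝒟.P, ← h, PMF.map_comp]
  rfl

variable {N : ℕ} {ι : Type} [Fintype ι] (rX : (Fin N → U) → ℝ≥0) (rι : ι → ℝ≥0)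

/-- The odds of the facts of a lottery. -/
def lotteryOdds : Fact (lotterySchema N ι) U → ℝ≥0 :=
  Sum.elim rX rι ∘ (lotteryFactEquiv N ι U).symm

theorem tsum_lotteryOdds :
    ∑' f, (lotteryOdds rX rι f : ℝ≥0∞) = ∑' x, (rX x : ℝ≥0∞) + ∑ i, (rι i : ℝ≥0∞) := by
  rw [← (lotteryFactEquiv N ι U).tsum_eq, Summable.tsum_sum ENNReal.summable ENNReal.summable,
    tsum_fintype (fun i : ι => _)]
  simp [lotteryOdds]

theorem weight_lotteryOdds_symm (E : Finset (Fin N → U)) (S : Finset ι) :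
    weight (lotteryOdds rX rι) ((lotteryEquiv N ι U).symm (E, S)) = weight rX E * weight rι S := by
  refine Eq.trans ?_ (weight_disjSum (Sum.elim rX rι) E S)
  change weight _ (Finset.map _ (E.disjSum S)) = _
  rw [weight, Finset.prod_map]
  simp [lotteryOdds, weight]

theorem tsum_lottery (f : Finset (Fin N → U) → Finset ι → ℝ≥0∞) :
    ∑' X : Instance (lotterySchema N ι) U, f (lotteryEquiv N ι U X).1 (lotteryEquiv N ι U X).2 =
      ∑' S, ∑' E, f E S := by
  rw [(lotteryEquiv N ι U).tsum_eq fun x => f x.1 x.2, ENNReal.tsum_prod, ENNReal.tsum_comm]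

theorem weight_lotteryOdds_apply (X : Instance (lotterySchema N ι) U) :
    weight (lotteryOdds rX rι) X =
      weight rX (lotteryEquiv N ι U X).1 * weight rι (lotteryEquiv N ι U X).2 := by
  rw [← weight_lotteryOdds_symm]
  simp

theorem totalWeight_lotteryOdds :
    totalWeight (lotteryOdds rX rι) = totalWeight rX * totalWeight rι := by
  simp only [totalWeight, weight_lotteryOdds_apply]
  rw [tsum_lottery fun E S => weight rX E * weight rι S]
  simp only [ENNReal.tsum_mul_right, ENNReal.tsum_mul_left]

end Image

end ProbDB

open ProbDB in
theorem mainTheorem8 {U : Type*} [Countable U] [Infinite U] (τ : ProbDB.Schema)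
    (𝒟 : ProbDB.PDB τ U) (h𝒟 : 𝒟.HasBoundedSize) : 𝒟.InFOTI := by
  obtain ⟨c, hc⟩ := h𝒟
  obtain ⟨N, dec, hdec, hval, hdef⟩ := exists_encoding (U := U) τ c
  obtain ⟨ι, _, rX, rι, g, D₀, hrX, hlot⟩ := exists_lottery (𝒟.P.map Subtype.val) dec
    fun D hD => hdec D (hc D (PDB.mem_worlds_iff.2 hD))
  obtain ⟨V, hV⟩ := exists_lottery_view hval (hdef (lotterySchema N ι)) g D₀
  have hr : ∑' f, (lotteryOdds rX rι f : ENNReal) ≠ ⊤ := by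
    rw [tsum_lotteryOdds]
    exact ENNReal.add_ne_top.2 ⟨hrX, ENNReal.sum_ne_top.2 fun _ _ => ENNReal.coe_ne_top⟩
  refine ⟨lotterySchema N ι, tiPDB (lotteryOdds rX rι) hr, V, tiPDB_isTI _ hr,
    PDB.isImage_of_map_eq (tiPDB_mem_support _ hr) (PMF.ext fun D => ?_)⟩
  classical
  -- Both sides become sums of unnormalized weights over the draws with result `D`, so `hlot`
  -- applies after clearing `totalWeight`.
  have h' := tiPDB_tsum (lotteryOdds rX rι) hr fun X => D = V.apply X
  refine (PMF.map_apply _ _ _).trans (Eq.trans (by congr!) (h'.trans ?_))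
  have h := tsum_lottery fun E S =>
    if lotteryResult dec g D₀ E S = D then weight rX E * weight rι S else 0
  have hD := hlot D
  rw [← totalWeight_lotteryOdds] at hD
  replace h := h.trans (Eq.trans (by congr!) hD)
  refine ((ENNReal.eq_div_iff (totalWeight_ne_zero _) (totalWeight_ne_top hr)).2 ?_).symm
  rw [mul_comm, ← h]
  refine tsum_congr fun X => ?_
  simp only [hV, lotteryInstance, weight_lotteryOdds_apply, eq_comm]
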